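/- Let $n\ge 0$, let $\sigma\in B_n$ be an element of the Artin braid group with generators $\sigma_1,\dots,\sigma_{n-1}$, and let $w\in\mathbb Z$ be its writhe, i.e. its image under the homomorphism $B_n\to\mathbb Z$ with $\sigma_i\mapsto 1$. Let $\beta$ be any word in the $\sigma_i^{\pm1}$ representing $\sigma$, and let $\mathcal D\subset S^2\setminus\{\mathbb O,\mathbb X\}$ be the diagram of the annular closure $\widehat\sigma$ given by closing $\beta$ around $\mathbb X$, with the braid-like orientation $o_\uparrow$ (all strands wind counterclockwise about $\mathbb X$); $\sigma_i$ gives a positive crossing. Let $(\mathcal C,\partial^{Lee})$ be the Lee complex of $\mathcal D$ over $\mathbb C$. It has the distinguished basis of all resolutions of $\mathcal D$ with every circle marked $v_+$ or $v_-$, and its differential is the signed sum, over the edges of the cube of resolutions, of the merge maps $v_\pm\otimes v_\pm\mapsto v_+$, $v_\pm\otimes v_\mp\mapsto v_-$ and the split maps $v_+\mapsto v_+\otimes v_-+v_-\otimes v_+$, $v_-\mapsto v_-\otimes v_-+v_+\otimes v_+$. For a distinguished basis element $\mathbf x$ let $$j(\mathbf x)=\#v_+-\#v_-+\#\{1\text{-resolutions}\}+n_+-2n_-,$$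 where $n_\pm$ is the number of positive/negative crossings, let $k(\mathbf x)$ be the number of $v_+$ minus the number of $v_-$ on the nontrivial circles (those meeting an arc $\gamma$ from $\mathbb X$ to $\mathbb O$ that misses the crossings in an odd number of points), and for $t\in[0,2]$ let $j_t=j-t\,k$. For $0\ne x\in\mathcal C$ let $\mathrm{gr}_{j_t}(x)$ be the largest $a\in\mathbb R$ such that $x$ lies in the span of the distinguished basis elements with $j_t\ge a$, and for $0\neq\eta\in H_*(\mathcal C,\partial^{Lee})$ let $\mathrm{gr}_{j_t}(\eta)=\max\{\mathrm{gr}_{j_t}(z): [z]=\eta\}$. Let $\mathfrak s_{o_\uparrow}\in\mathcal C$ be Lee's canonical element: the oriented resolution of $(\mathcal D,o_\uparrow)$, consisting of $n$ nested circles, marked from the outermost to the innermost circle alternately by $\mathbf b=v_--v_+$ and $\mathbf a=v_-+v_+$, starting with $\mathbf b$. The annular Rasmussen invariant is $d_t(\widehat\sigma,o_\uparrow)=\mathrm{gr}_{j_t}([\mathfrak s_{o_\uparrow}])$. Then $\mathfrak s_{o_\uparrow}$ is a cycle, its homology class is nonzero, the maximum defining $d_1(\widehat\sigma,o_\uparrow)$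 exists, and $$d_1(\widehat\sigma,o_\uparrow)=w.$$ -/

import Mathlib

namespace AnnularLee

/-! ### Braid groups -/

/-- The Artin relations on the free group with generators `σ_0, …, σ_{n-2}`: far commutation and the
braid relation. -/
def braidRels (n : ℕ) : Set (FreeGroup (Fin (n - 1))) :=
  {r | ∃ i j : Fin (n - 1), (i : ℕ) + 1 < j ∧
      r = FreeGroup.of i * FreeGroup.of j * (FreeGroup.of j * FreeGroup.of i)⁻¹} ∪
  {r | ∃ i j : Fin (n - 1), (i : ℕ) + 1 = j ∧
      r = FreeGroup.of i * FreeGroup.of j * FreeGroup.of i *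
        (FreeGroup.of j * FreeGroup.of i * FreeGroup.of j)⁻¹}

/-- Artin's braid group `B_n` on `n` strands. -/
abbrev BraidGroup (n : ℕ) : Type := PresentedGroup (braidRels n)

/-- The writhe (exponent sum) homomorphism `B_n → ℤ`, sending every `σ_i` to `1`. -/
def writheHom (n : ℕ) : BraidGroup n →* Multiplicative ℤ :=
  PresentedGroup.toGroup (rels := braidRels n) (f := fun _ => Multiplicative.ofAdd 1) (by
    rintro r (⟨i, j, _, rfl⟩ | ⟨i, j, _, rfl⟩) <;> simp)

/-- The writhe of a braid. -/
def writhe {n : ℕ} (σ : BraidGroup n) : ℤ := Multiplicative.toAdd (writheHom n σ)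

/-- A word in the letters `σ_i = (i, true)` and `σ_i⁻¹ = (i, false)`. -/
abbrev BraidWord (n : ℕ) : Type := List (Fin (n - 1) × Bool)

/-- The braid represented by a word. -/
def BraidWord.toBraid {n : ℕ} (β : BraidWord n) : BraidGroup n :=
  PresentedGroup.mk (braidRels n) (FreeGroup.mk β)

/-! ### The annular closure of a braid word and its resolutions

The braid runs upwards; its `m = β.length` crossings sit between the `m + 1` levels `0, …, m`, the
`ℓ`-th crossing (between levels `ℓ` and `ℓ + 1`) being the `ℓ`-th letter of the word. The positions
`0, …, n - 1` at each level are numbered from left to right. The closure joins `(m, p)` to `(0, p)`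
by `n` nested parallel arcs passing to the left of the braid, around the basepoint `X`. Thus the
braid-like orientation winds counterclockwise about `X`, and the strand at position `p` lies
inside the strands at positions `q > p`. The arc `γ` from `X` to the outer basepoint `O` is chosen
to meet each of the `n` closing arcs once and to meet nothing else. -/

variable {n : ℕ}

/-- The left-hand strand position of the `ℓ`-th crossing. -/
def leftPos (β : BraidWord n) (ℓ : Fin β.length) : Fin n :=
  ⟨(β.get ℓ).1, by have := (β.get ℓ).1.isLt; omega⟩

/-- The right-hand strand position of the `ℓ`-th crossing. -/
def rightPos (β : BraidWord n) (ℓ : Fin β.length) : Fin n :=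
  ⟨(β.get ℓ).1 + 1, by have := (β.get ℓ).1.isLt; omega⟩

/-- A Kauffman state (complete resolution), i.e. a vertex of the cube of resolutions: `false` is the
`0`-resolution and `true` the `1`-resolution of a crossing. -/
abbrev State (β : BraidWord n) : Type := Fin β.length → Bool

/-- The braid-like (oriented) resolution of a positive crossing is its `0`-resolution, that of a
negative crossing is its `1`-resolution. The resolution of the crossing `ℓ` in the state `s` is
braid-like (two vertical arcs) if this holds; otherwise it consists of two horizontal arcs. -/
def IsVertical (β : BraidWord n) (s : State β) (ℓ : Fin β.length) : Prop :=
  s ℓ = !(β.get ℓ).2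

/-- The points `(level, position)` of the closed braid diagram. -/
abbrev Point (β : BraidWord n) : Type := Fin (β.length + 1) × Fin n

/-- The arcs of the resolution `s`, recorded by their end points. -/
inductive Arc (β : BraidWord n) (s : State β) : Point β → Point β → Prop
  | closing (p : Fin n) : Arc β s (Fin.last _, p) (0, p)
  | strand (ℓ : Fin β.length) (p : Fin n) (hl : p ≠ leftPos β ℓ) (hr : p ≠ rightPos β ℓ) :
      Arc β s (ℓ.castSucc, p) (ℓ.succ, p)
  | verticalLeft (ℓ : Fin β.length) (h : IsVertical β s ℓ) :
      Arc β s (ℓ.castSucc, leftPos β ℓ) (ℓ.succ, leftPos β ℓ)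
  | verticalRight (ℓ : Fin β.length) (h : IsVertical β s ℓ) :
      Arc β s (ℓ.castSucc, rightPos β ℓ) (ℓ.succ, rightPos β ℓ)
  | horizontalLower (ℓ : Fin β.length) (h : ¬ IsVertical β s ℓ) :
      Arc β s (ℓ.castSucc, leftPos β ℓ) (ℓ.castSucc, rightPos β ℓ)
  | horizontalUpper (ℓ : Fin β.length) (h : ¬ IsVertical β s ℓ) :
      Arc β s (ℓ.succ, leftPos β ℓ) (ℓ.succ, rightPos β ℓ)

/-- The circles of the resolution `s`: the classes of points under the equivalence relation
generated by being joined by an arc. -/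
def StateCircle (β : BraidWord n) (s : State β) : Type := Quot (Arc β s)

/-- The circle of the resolution `s` through a given point. -/
def circleAt (β : BraidWord n) (s : State β) (P : Point β) : StateCircle β s := Quot.mk _ P

instance (β : BraidWord n) (s : State β) : Finite (StateCircle β s) :=
  inferInstanceAs (Finite (Quot (Arc β s)))

noncomputable instance (β : BraidWord n) (s : State β) : Fintype (StateCircle β s) :=
  Fintype.ofFinite _

/-- A circle is nontrivial if it meets the arc `γ` in an odd number of points. -/
def IsNontrivial (β : BraidWord n) (s : State β) (c : StateCircle β s) : Prop :=
  Odd (Set.ncard {p : Fin n | circleAt β s (0, p) = c})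

/-! ### The Khovanov-Lee complex -/

/-- The distinguished basis elements: a resolution together with a marking of each of its circles
by `v₊` (written `1 : ℤˣ`) or `v₋` (written `-1 : ℤˣ`). -/
abbrev Generator (β : BraidWord n) : Type := Σ s : State β, (StateCircle β s → ℤˣ)

noncomputable instance (β : BraidWord n) : Fintype (Generator β) := Fintype.ofFinite _

/-- The marking of the circle through a point. -/
def Generator.mark {β : BraidWord n} (g : Generator β) (P : Point β) : ℤˣ :=
  g.2 (circleAt β g.1 P)

/-- The vector space underlying the Khovanov-Lee complex, with complex coefficients; the
coordinates of a chain are taken in the distinguished basis. -/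
abbrev Chain (β : BraidWord n) : Type := Generator β → ℂ

/-- The number of positive crossings. -/
def numPos (β : BraidWord n) : ℕ := β.countP fun x => x.2

/-- The number of negative crossings. -/
def numNeg (β : BraidWord n) : ℕ := β.countP fun x => !x.2

/-- The quantum grading `j` of a generator: number of `v₊` minus number of `v₋`, plus number of
`1`-resolutions, shifted by `n₊ - 2 n₋`. -/
noncomputable def jGrading {β : BraidWord n} (g : Generator β) : ℤ :=
  (∑ c, (g.2 c : ℤ)) + (Finset.univ.filter fun ℓ => g.1 ℓ = true).card +
    (numPos β : ℤ) - 2 * (numNeg β : ℤ)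

open Classical in
/-- The annular grading `k` of a generator: the algebraic intersection number with `γ` of the state
in which a circle marked `v₊` is oriented counterclockwise and one marked `v₋` clockwise. A
nontrivial circle contributes `±1` accordingly, a trivial circle contributes `0`. -/
noncomputable def kGrading {β : BraidWord n} (g : Generator β) : ℤ :=
  ∑ c, if IsNontrivial β g.1 c then (g.2 c : ℤ) else 0

/-- The grading `j_t = j - t k`. -/
noncomputable def jtGrading {β : BraidWord n} (t : ℝ) (g : Generator β) : ℝ :=
  (jGrading g : ℝ) - t * (kGrading g : ℝ)

/-- The lower left end of the crossing `ℓ`. In both resolutions of the crossing this point and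
`upperEnd` lie on different local arcs, and each of the two local arcs contains one of them. -/
def lowerEnd (β : BraidWord n) (ℓ : Fin β.length) : Point β := (ℓ.castSucc, leftPos β ℓ)

/-- The upper right end of the crossing `ℓ`. -/
def upperEnd (β : BraidWord n) (ℓ : Fin β.length) : Point β := (ℓ.succ, rightPos β ℓ)

/-- `g'` occurs in the image of `g` under the merge map of the crossing `ℓ`:
`v₊ ⊗ v₊ ↦ v₊`, `v₊ ⊗ v₋ ↦ v₋`, `v₋ ⊗ v₊ ↦ v₋`, `v₋ ⊗ v₋ ↦ v₊`
(the last one being the Lee deformation). -/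
def IsMergeTerm {β : BraidWord n} (ℓ : Fin β.length) (g g' : Generator β) : Prop :=
  circleAt β g.1 (lowerEnd β ℓ) ≠ circleAt β g.1 (upperEnd β ℓ) ∧
  circleAt β g'.1 (lowerEnd β ℓ) = circleAt β g'.1 (upperEnd β ℓ) ∧
  g'.mark (lowerEnd β ℓ) = g.mark (lowerEnd β ℓ) * g.mark (upperEnd β ℓ)

/-- `g'` occurs in the image of `g` under the split map of the crossing `ℓ`:
`v₊ ↦ v₊ ⊗ v₋ + v₋ ⊗ v₊`, `v₋ ↦ v₋ ⊗ v₋ + v₊ ⊗ v₊`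
(the last term being the Lee deformation). -/
def IsSplitTerm {β : BraidWord n} (ℓ : Fin β.length) (g g' : Generator β) : Prop :=
  circleAt β g.1 (lowerEnd β ℓ) = circleAt β g.1 (upperEnd β ℓ) ∧
  circleAt β g'.1 (lowerEnd β ℓ) ≠ circleAt β g'.1 (upperEnd β ℓ) ∧
  g'.mark (lowerEnd β ℓ) * g'.mark (upperEnd β ℓ) = -g.mark (lowerEnd β ℓ)

/-- `g'` occurs in the image of `g` under the map belonging to the edge of the cube that changes the
`0`-resolution of the crossing `ℓ` to its `1`-resolution: the circles away from the crossing keep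
their markings, those at the crossing merge or split. -/
def IsEdgeTerm {β : BraidWord n} (ℓ : Fin β.length) (g g' : Generator β) : Prop :=
  g.1 ℓ = false ∧ g'.1 = Function.update g.1 ℓ true ∧
  (∀ P : Point β, circleAt β g.1 P ≠ circleAt β g.1 (lowerEnd β ℓ) →
    circleAt β g.1 P ≠ circleAt β g.1 (upperEnd β ℓ) → g'.mark P = g.mark P) ∧
  (IsMergeTerm ℓ g g' ∨ IsSplitTerm ℓ g g')

open Classical in
/-- The matrix entry of the Lee differential from `g` to `g'`, with the usual cube sign. -/
noncomputable def leeCoeff {β : BraidWord n} (g g' : Generator β) : ℂ :=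
  ∑ ℓ : Fin β.length, if IsEdgeTerm ℓ g g' then
    (-1) ^ (Finset.univ.filter fun k => k < ℓ ∧ g.1 k = true).card else 0

/-- The Lee differential `∂ + Φ`. -/
noncomputable def leeDifferential (β : BraidWord n) : Chain β →ₗ[ℂ] Chain β :=
  Matrix.mulVecLin (Matrix.of fun g' g => leeCoeff g g')

/-! ### The filtrations and the annular Rasmussen invariants -/

open Classical in
/-- The piece at `a` of the filtration induced by `j_t`: the span of the distinguished basis
elements with `j_t ≥ a`. -/
noncomputable def filtration (β : BraidWord n) (t a : ℝ) : Submodule ℂ (Chain β) :=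
  Submodule.span ℂ {x | ∃ g : Generator β, a ≤ jtGrading t g ∧ x = Pi.single g 1}

/-- The `j_t`-filtration grading of a (nonzero) chain: the largest `a` such that the chain lies
in the piece at `a`. -/
noncomputable def chainGrading (β : BraidWord n) (t : ℝ) (x : Chain β) : ℝ :=
  sSup {a | x ∈ filtration β t a}

/-- The `j_t`-gradings of the cycles homologous to `x`. -/
def classGradings (β : BraidWord n) (t : ℝ) (x : Chain β) : Set ℝ :=
  {r | ∃ z, leeDifferential β z = 0 ∧ z - x ∈ LinearMap.range (leeDifferential β) ∧
    chainGrading β t z = r}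

/-- The braid-like resolution of the closed braid diagram. Its circles are the `n` nested closed
strands, one for every position. -/
def braidlikeState (β : BraidWord n) : State β := fun ℓ => !(β.get ℓ).2

/-- In the braid-like resolution with the orientation `o_↑`, all circles are counterclockwise.
The canonical marking of such a circle is `b` if it is separated from infinity by an even number of
circles, and `a` otherwise; the circle at position `p` is inside the circles at the positions
`q > p`. -/
def IsMarkedB (p : Fin n) : Prop := Even (Finset.univ.filter fun q : Fin n => p < q).card

open Classical in
/-- The canonical Lee cycle `𝔰_o` for the braid-like orientation `o = o_↑`: the circles of the
braid-like resolution are marked by `a = v₋ + v₊` or `b = v₋ - v₊`, alternately, starting with `b`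
for the outermost circle. Expanded in the distinguished basis, a marking contributes one factor
`-1` for every circle that has canonical marking `b` and is marked `v₊`. -/
noncomputable def canonicalCycle (β : BraidWord n) : Chain β := fun g =>
  if g.1 = braidlikeState β then
    ∏ p : Fin n, if IsMarkedB p ∧ g.mark (0, p) = 1 then -1 else 1
  else 0

/-- The annular Rasmussen invariant `d_t(σ̂, o_↑)` of the closure of the braid word `β`: the
`j_t`-grading of the homology class of the canonical cycle, that is the largest grading of a cycle
representing this class. -/
noncomputable def annularRasmussen (β : BraidWord n) (t : ℝ) : ℝ :=
  sSup (classGradings β t (canonicalCycle β))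

end AnnularLee

/-! Reversing the marks of the two circles that meet a crossing of the braid-like resolution changes
no merge map out of it and no split map into it: the product of the two marks stays the same. It
does reverse the sign of the canonical chain, because nested neighbours carry different canonical
markings. Cancelling in pairs, the canonical chain is annihilated by the Lee differential and by its
transpose. Since it is real and nonzero, it pairs nontrivially with itself, and hence with every
cycle homologous to it, so each such cycle involves a generator over the braid-like resolution. All
circles of that resolution are nontrivial, so `j - k` does not depend on their marks and equals
`n₊ - n₋` there. This bounds `d_1` from above, and the canonical cycle attains the bound. -/

namespace AnnularLee

open scoped Matrix

variable {n : ℕ} {β : BraidWord n}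

/-! ### Filtration gradings -/

lemma mem_filtration_iff {t a : ℝ} {x : Chain β} :
    x ∈ filtration β t a ↔ ∀ g, x g ≠ 0 → a ≤ jtGrading t g := by
  have h : {x : Chain β | ∃ g, a ≤ jtGrading t g ∧ x = Pi.single g 1} =
      Pi.basisFun ℂ (Generator β) '' {g | a ≤ jtGrading t g} := by
    ext x
    simp [eq_comm]
  have hspan : filtration β t a =
      Submodule.span ℂ (Pi.basisFun ℂ (Generator β) '' {g | a ≤ jtGrading t g}) := by
    rw [← h, filtration]
  rw [hspan, Module.Basis.mem_span_image]
  simp [Set.subset_def]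

lemma chainGrading_le {t : ℝ} {x : Chain β} {g : Generator β} (hg : x g ≠ 0) :
    chainGrading β t x ≤ jtGrading t g := by
  obtain ⟨a, ha⟩ := (Set.finite_range (jtGrading (β := β) t)).bddBelow
  exact csSup_le ⟨a, mem_filtration_iff.2 fun g' _ => ha ⟨g', rfl⟩⟩
    fun b hb => mem_filtration_iff.1 hb g hg

lemma le_chainGrading {t a : ℝ} {x : Chain β} (hx : x ≠ 0)
    (ha : ∀ g, x g ≠ 0 → a ≤ jtGrading t g) : a ≤ chainGrading β t x := by
  obtain ⟨g, hg⟩ := Function.ne_iff.1 hx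
  exact le_csSup ⟨jtGrading t g, fun b hb => mem_filtration_iff.1 hb g hg⟩
    (mem_filtration_iff.2 ha)

lemma mem_upperBounds_classGradings {t b : ℝ} {x c : Chain β}
    (hc : ∀ y, c ⬝ᵥ leeDifferential β y = 0) (hb : ∀ g, c g ≠ 0 → jtGrading t g ≤ b)
    (hx : c ⬝ᵥ x ≠ 0) : b ∈ upperBounds (classGradings β t x) := by
  rintro _ ⟨z, -, ⟨y, hy⟩, rfl⟩
  have hz : c ⬝ᵥ z = c ⬝ᵥ x := by rw [← sub_eq_zero, ← dotProduct_sub, ← hy, hc]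
  obtain ⟨g, -, hg⟩ := Finset.exists_ne_zero_of_sum_ne_zero (hz ▸ hx)
  exact (chainGrading_le (right_ne_zero_of_mul hg)).trans (hb g (left_ne_zero_of_mul hg))

/-! ### The braid-like resolution -/

lemma Arc.snd_eq {P Q : Point β} (h : Arc β (braidlikeState β) P Q) : P.2 = Q.2 := by
  cases h with
  | horizontalLower ℓ h | horizontalUpper ℓ h => exact absurd rfl h
  | _ => rfl

lemma circleAt_braidlikeState_zero (i : Fin (β.length + 1)) (p : Fin n) :
    circleAt β (braidlikeState β) (i, p) = circleAt β (braidlikeState β) (0, p) := by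
  induction i using Fin.induction with
  | zero => rfl
  | succ ℓ ih =>
    have harc : Arc β (braidlikeState β) (ℓ.castSucc, p) (ℓ.succ, p) := by
      by_cases hl : p = leftPos β ℓ
      · exact hl ▸ .verticalLeft ℓ rfl
      by_cases hr : p = rightPos β ℓ
      · exact hr ▸ .verticalRight ℓ rfl
      exact .strand ℓ p hl hr
    exact (Quot.sound harc).symm.trans ih

lemma circleAt_braidlikeState_eq_iff {P Q : Point β} :
    circleAt β (braidlikeState β) P = circleAt β (braidlikeState β) Q ↔ P.2 = Q.2 := by
  refine ⟨congrArg (Quot.lift Prod.snd fun _ _ => Arc.snd_eq), fun h => ?_⟩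
  rw [← P.eta, ← Q.eta, circleAt_braidlikeState_zero, circleAt_braidlikeState_zero Q.1, h]

lemma circleAt_lowerEnd_ne_upperEnd {s : State β} (hs : s = braidlikeState β) (ℓ : Fin β.length) :
    circleAt β s (lowerEnd β ℓ) ≠ circleAt β s (upperEnd β ℓ) := by
  subst hs
  simp [circleAt_braidlikeState_eq_iff, lowerEnd, upperEnd, leftPos, rightPos]

lemma isNontrivial_braidlikeState (c : StateCircle β (braidlikeState β)) :
    IsNontrivial β (braidlikeState β) c := by
  obtain ⟨⟨i, p⟩, rfl⟩ : ∃ P, circleAt β _ P = c := Quot.exists_rep c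
  simp [IsNontrivial, circleAt_braidlikeState_eq_iff]

lemma card_filter_get_eq_countP {α : Type*} (l : List α) (p : α → Bool) :
    (Finset.univ.filter fun i => p (l.get i) = true).card = l.countP p := by
  conv_rhs => rw [← List.map_get_finRange l, List.countP_map, List.countP_eq_length_filter]
  exact congrArg (fun L : List (Fin l.length) => L.length) (by simp [Function.comp_def])

lemma writhe_toBraid (β : BraidWord n) : writhe β.toBraid = numPos β - numNeg β := by
  have h : writhe β.toBraid = Multiplicative.toAdd (β.map fun x =>
      bif x.2 then Multiplicative.ofAdd (1 : ℤ) else (Multiplicative.ofAdd 1)⁻¹).prod :=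
    congrArg Multiplicative.toAdd
      (FreeGroup.lift_mk (L := β) (f := fun _ => Multiplicative.ofAdd (1 : ℤ)))
  rw [h]
  clear h
  induction β with
  | nil => rfl
  | cons x β ih =>
    rw [List.map_cons, List.prod_cons, toAdd_mul, ih]
    rcases hx : x.2 <;>
      simp only [numPos, numNeg, hx, cond_true, cond_false, toAdd_inv, toAdd_ofAdd,
        List.countP_cons, Bool.not_true, Bool.not_false, Bool.false_eq_true, if_true, if_false,
        Nat.cast_add, Nat.cast_one, Nat.cast_zero] <;>
      ring

lemma jtGrading_of_braidlike {g : Generator β} (hg : g.1 = braidlikeState β) (t : ℝ) :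
    jtGrading t g = writhe β.toBraid + (1 - t) * kGrading g := by
  obtain ⟨s, m⟩ := g
  obtain rfl : s = braidlikeState β := hg
  have hcard : (Finset.univ.filter fun ℓ => braidlikeState β ℓ = true).card = numNeg β :=
    card_filter_get_eq_countP β fun x => !x.2
  have hk : kGrading (⟨braidlikeState β, m⟩ : Generator β) = ∑ c, (m c : ℤ) :=
    Finset.sum_congr rfl fun c _ => if_pos (isNontrivial_braidlikeState c)
  rw [jtGrading, jGrading, hcard, ← hk, writhe_toBraid]
  push_cast
  ring

/-! ### Reversing the marks at a crossing -/

/-- The circle `c` passes through the crossing `ℓ`. -/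
def MeetsCrossing {s : State β} (ℓ : Fin β.length) (c : StateCircle β s) : Prop :=
  c = circleAt β s (lowerEnd β ℓ) ∨ c = circleAt β s (upperEnd β ℓ)

open Classical in
/-- The involution of the generators that reverses the marks of the circles through the crossing
`ℓ`. -/
noncomputable def flipAt (ℓ : Fin β.length) (g : Generator β) : Generator β :=
  ⟨g.1, fun c => if MeetsCrossing ℓ c then -g.2 c else g.2 c⟩

lemma flipAt_fst (ℓ : Fin β.length) (g : Generator β) : (flipAt ℓ g).1 = g.1 := rfl

lemma flipAt_flipAt (ℓ : Fin β.length) (g : Generator β) : flipAt ℓ (flipAt ℓ g) = g := by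
  refine congrArg (Sigma.mk g.1) (funext fun c => ?_)
  by_cases hc : MeetsCrossing ℓ c
  · exact (if_pos hc).trans (neg_eq_iff_eq_neg.2 (if_pos hc))
  · exact (if_neg hc).trans (if_neg hc)

lemma mark_flipAt_of_meetsCrossing {ℓ : Fin β.length} {g : Generator β} {P : Point β}
    (hP : MeetsCrossing ℓ (circleAt β g.1 P)) : (flipAt ℓ g).mark P = -g.mark P :=
  if_pos hP

lemma mark_flipAt_of_not_meetsCrossing {ℓ : Fin β.length} {g : Generator β} {P : Point β}
    (hP : ¬ MeetsCrossing ℓ (circleAt β g.1 P)) : (flipAt ℓ g).mark P = g.mark P :=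
  if_neg hP

lemma mark_flipAt_lowerEnd (ℓ : Fin β.length) (g : Generator β) :
    (flipAt ℓ g).mark (lowerEnd β ℓ) = -g.mark (lowerEnd β ℓ) :=
  mark_flipAt_of_meetsCrossing (.inl rfl)

lemma mark_flipAt_upperEnd (ℓ : Fin β.length) (g : Generator β) :
    (flipAt ℓ g).mark (upperEnd β ℓ) = -g.mark (upperEnd β ℓ) :=
  mark_flipAt_of_meetsCrossing (.inr rfl)

lemma meetsCrossing_corners (s : State β) (ℓ : Fin β.length) :
    MeetsCrossing ℓ (circleAt β s (ℓ.castSucc, leftPos β ℓ)) ∧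
    MeetsCrossing ℓ (circleAt β s (ℓ.castSucc, rightPos β ℓ)) ∧
    MeetsCrossing ℓ (circleAt β s (ℓ.succ, leftPos β ℓ)) ∧
    MeetsCrossing ℓ (circleAt β s (ℓ.succ, rightPos β ℓ)) := by
  by_cases hv : IsVertical β s ℓ
  · exact ⟨.inl rfl, .inr (Quot.sound (.verticalRight ℓ hv)),
      .inl (Quot.sound (.verticalLeft ℓ hv)).symm, .inr rfl⟩
  · exact ⟨.inl rfl, .inl (Quot.sound (.horizontalLower ℓ hv)).symm,
      .inr (Quot.sound (.horizontalUpper ℓ hv)), .inr rfl⟩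

lemma isVertical_update_iff {s : State β} {ℓ k : Fin β.length} {b : Bool} (hk : k ≠ ℓ) :
    IsVertical β (Function.update s ℓ b) k ↔ IsVertical β s k := by
  rw [IsVertical, IsVertical, Function.update_of_ne hk]

lemma Arc.of_update {s : State β} {ℓ : Fin β.length} {b : Bool} {P Q : Point β}
    (h : Arc β (Function.update s ℓ b) P Q) :
    Arc β s P Q ∨ MeetsCrossing ℓ (circleAt β s P) ∧ MeetsCrossing ℓ (circleAt β s Q) := by
  obtain ⟨hll, hlr, hul, hur⟩ := meetsCrossing_corners s ℓ
  cases h with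
  | closing p => exact .inl (.closing p)
  | strand k p hl hr => exact .inl (.strand k p hl hr)
  | verticalLeft k h =>
    rcases eq_or_ne k ℓ with rfl | hk
    exacts [.inr ⟨hll, hul⟩, .inl (.verticalLeft k ((isVertical_update_iff hk).1 h))]
  | verticalRight k h =>
    rcases eq_or_ne k ℓ with rfl | hk
    exacts [.inr ⟨hlr, hur⟩, .inl (.verticalRight k ((isVertical_update_iff hk).1 h))]
  | horizontalLower k h =>
    rcases eq_or_ne k ℓ with rfl | hk
    exacts [.inr ⟨hll, hlr⟩, .inl (.horizontalLower k (mt (isVertical_update_iff hk).2 h))]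
  | horizontalUpper k h =>
    rcases eq_or_ne k ℓ with rfl | hk
    exacts [.inr ⟨hul, hur⟩, .inl (.horizontalUpper k (mt (isVertical_update_iff hk).2 h))]

lemma meetsCrossing_of_update {s : State β} {ℓ : Fin β.length} {b : Bool} {P : Point β}
    (h : MeetsCrossing ℓ (circleAt β (Function.update s ℓ b) P)) :
    MeetsCrossing ℓ (circleAt β s P) := by
  have harc (P Q : Point β) (hPQ : Arc β (Function.update s ℓ b) P Q) :
      MeetsCrossing ℓ (circleAt β s P) = MeetsCrossing ℓ (circleAt β s Q) := by
    rcases hPQ.of_update with hPQ | ⟨hP, hQ⟩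
    · exact congrArg (MeetsCrossing ℓ) (Quot.sound hPQ)
    · exact propext (iff_of_true hP hQ)
  rcases h with h | h <;> refine (congrArg (Quot.lift _ harc) h).mpr ?_
  exacts [.inl rfl, .inr rfl]

lemma isEdgeTerm_flipAt_left_iff {ℓ : Fin β.length} {g g' : Generator β}
    (hg : circleAt β g.1 (lowerEnd β ℓ) ≠ circleAt β g.1 (upperEnd β ℓ)) :
    IsEdgeTerm ℓ (flipAt ℓ g) g' ↔ IsEdgeTerm ℓ g g' := by
  refine and_congr Iff.rfl (and_congr Iff.rfl (and_congr (forall₃_congr fun P hl hu => ?_) ?_))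
  · rw [mark_flipAt_of_not_meetsCrossing (g := g) (not_or.2 ⟨hl, hu⟩)]
  · simp only [IsMergeTerm, IsSplitTerm, flipAt_fst, mark_flipAt_lowerEnd, mark_flipAt_upperEnd,
      neg_mul_neg, hg, false_and]

lemma isEdgeTerm_flipAt_right_iff {ℓ : Fin β.length} {g g' : Generator β}
    (hg' : circleAt β g'.1 (lowerEnd β ℓ) ≠ circleAt β g'.1 (upperEnd β ℓ)) :
    IsEdgeTerm ℓ g (flipAt ℓ g') ↔ IsEdgeTerm ℓ g g' := by
  refine and_congr Iff.rfl (and_congr_right fun hstate =>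
    and_congr (forall₃_congr fun P hl hu => ?_) ?_)
  · have hP : ¬ MeetsCrossing ℓ (circleAt β g'.1 P) := fun h =>
      not_or.2 ⟨hl, hu⟩ (meetsCrossing_of_update (hstate ▸ h))
    rw [mark_flipAt_of_not_meetsCrossing hP]
  · simp only [IsMergeTerm, IsSplitTerm, flipAt_fst, mark_flipAt_lowerEnd, mark_flipAt_upperEnd,
      neg_mul_neg, hg', false_and, and_false]

/-! ### The canonical cycle -/

lemma isMarkedB_iff_not_of_covBy {p q : Fin n} (h : p ⋖ q) : IsMarkedB p ↔ ¬ IsMarkedB q := by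
  have hcard : (Finset.univ.filter (p < ·)).card = (Finset.univ.filter (q < ·)).card + 1 := by
    have hIoi : Finset.univ.filter (p < ·) = insert q (Finset.univ.filter (q < ·)) := by
      ext r
      simpa [eq_comm, le_iff_eq_or_lt] using Set.ext_iff.1 h.Ioi_eq r
    rw [hIoi, Finset.card_insert_of_notMem (by simp)]
  rw [IsMarkedB, IsMarkedB, hcard, Nat.even_add_one]

lemma leftPos_covBy_rightPos (ℓ : Fin β.length) : leftPos β ℓ ⋖ rightPos β ℓ := by
  simp [leftPos, rightPos]

lemma exists_isMarkedB_iff (ℓ : Fin β.length) :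
    ∃ q, ∀ p, (p = leftPos β ℓ ∨ p = rightPos β ℓ) ∧ IsMarkedB p ↔ p = q := by
  have h := isMarkedB_iff_not_of_covBy (leftPos_covBy_rightPos ℓ)
  by_cases hB : IsMarkedB (rightPos β ℓ)
  · exact ⟨rightPos β ℓ, by grind⟩
  · exact ⟨leftPos β ℓ, by grind⟩

lemma canonicalCycle_apply_ne_zero_iff {g : Generator β} :
    canonicalCycle β g ≠ 0 ↔ g.1 = braidlikeState β := by
  by_cases hg : g.1 = braidlikeState β <;>
    simp [canonicalCycle, hg, Finset.prod_eq_zero_iff, ite_eq_iff]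

lemma star_canonicalCycle : star (canonicalCycle β) = canonicalCycle β := by
  ext g
  simp [canonicalCycle, apply_ite (starRingEnd ℂ)]

lemma canonicalCycle_ne_zero : canonicalCycle β ≠ 0 :=
  Function.ne_iff.2 ⟨⟨braidlikeState β, 1⟩, canonicalCycle_apply_ne_zero_iff.2 rfl⟩

open scoped ComplexOrder in
lemma canonicalCycle_dotProduct_self_ne_zero : canonicalCycle β ⬝ᵥ canonicalCycle β ≠ 0 := by
  have h := (dotProduct_star_self_eq_zero (v := canonicalCycle β)).not.2 canonicalCycle_ne_zero
  rwa [star_canonicalCycle] at h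

lemma meetsCrossing_braidlike_iff {s : State β} (hs : s = braidlikeState β) {ℓ : Fin β.length}
    {P : Point β} :
    MeetsCrossing ℓ (circleAt β s P) ↔ P.2 = leftPos β ℓ ∨ P.2 = rightPos β ℓ := by
  subst hs
  simp only [MeetsCrossing, circleAt_braidlikeState_eq_iff, lowerEnd, upperEnd]

lemma canonicalCycle_flipAt (ℓ : Fin β.length) (g : Generator β) :
    canonicalCycle β (flipAt ℓ g) = -canonicalCycle β g := by
  by_cases hg : g.1 = braidlikeState β
  swap
  · simp [canonicalCycle, flipAt_fst, hg]
  classical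
  obtain ⟨q, hq⟩ := exists_isMarkedB_iff ℓ
  have hfactor (p : Fin n) :
      (if IsMarkedB p ∧ (flipAt ℓ g).mark (0, p) = 1 then (-1 : ℂ) else 1) =
        (if p = q then -1 else 1) * if IsMarkedB p ∧ g.mark (0, p) = 1 then -1 else 1 := by
    simp only [← hq]
    by_cases hp : p = leftPos β ℓ ∨ p = rightPos β ℓ
    · rw [mark_flipAt_of_meetsCrossing ((meetsCrossing_braidlike_iff hg).2 hp)]
      rcases Int.units_eq_one_or (g.mark (0, p)) with h | h <;>
        by_cases hB : IsMarkedB p <;> simp [h, hp, hB]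
    · rw [mark_flipAt_of_not_meetsCrossing (mt (meetsCrossing_braidlike_iff hg).1 hp)]
      simp [hp]
  simp only [canonicalCycle, flipAt_fst, hg, if_true, hfactor, Finset.prod_mul_distrib,
    Finset.prod_ite_eq', Finset.mem_univ, neg_one_mul]

lemma canonicalCycle_dotProduct_eq_zero (ℓ : Fin β.length) {f : Generator β → ℂ}
    (hf : ∀ g, g.1 = braidlikeState β → f (flipAt ℓ g) = f g) : canonicalCycle β ⬝ᵥ f = 0 := by
  have hneg (g : Generator β) :
      canonicalCycle β (flipAt ℓ g) * f (flipAt ℓ g) = -(canonicalCycle β g * f g) := by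
    rw [canonicalCycle_flipAt, neg_mul, neg_inj]
    by_cases hg : g.1 = braidlikeState β
    · rw [hf g hg]
    · simp [not_not.1 (mt canonicalCycle_apply_ne_zero_iff.1 hg)]
  refine Finset.sum_involution (fun g _ => flipAt ℓ g) (fun g _ => ?_) (fun g _ hg hfix => hg ?_)
    (fun g _ => Finset.mem_univ _) (fun g _ => flipAt_flipAt ℓ g)
  · rw [hneg, add_neg_cancel]
  · simpa only [hfix, self_eq_neg] using hneg g

open Classical in
/-- The matrix entry from `g` to `g'` of the signed edge maps at the crossing `ℓ`. -/
noncomputable def edgeCoeff (ℓ : Fin β.length) (g g' : Generator β) : ℂ :=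
  if IsEdgeTerm ℓ g g' then
    (-1) ^ (Finset.univ.filter fun k => k < ℓ ∧ g.1 k = true).card else 0

lemma edgeCoeff_flipAt_left {ℓ : Fin β.length} {g : Generator β} (g' : Generator β)
    (hg : g.1 = braidlikeState β) : edgeCoeff ℓ (flipAt ℓ g) g' = edgeCoeff ℓ g g' := by
  classical
  exact if_congr (isEdgeTerm_flipAt_left_iff (circleAt_lowerEnd_ne_upperEnd hg ℓ)) rfl rfl

lemma edgeCoeff_flipAt_right {ℓ : Fin β.length} (g : Generator β) {g' : Generator β}
    (hg' : g'.1 = braidlikeState β) : edgeCoeff ℓ g (flipAt ℓ g') = edgeCoeff ℓ g g' := by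
  classical
  exact if_congr (isEdgeTerm_flipAt_right_iff (circleAt_lowerEnd_ne_upperEnd hg' ℓ)) rfl rfl

lemma leeDifferential_canonicalCycle : leeDifferential β (canonicalCycle β) = 0 := by
  funext g'
  have hcol : (leeCoeff · g') = ∑ ℓ, (edgeCoeff (β := β) ℓ · g') :=
    (Finset.sum_fn _ _).symm
  change (leeCoeff · g') ⬝ᵥ canonicalCycle β = 0
  rw [dotProduct_comm, hcol, dotProduct_sum]
  exact Finset.sum_eq_zero fun ℓ _ =>
    canonicalCycle_dotProduct_eq_zero ℓ fun g => edgeCoeff_flipAt_left g'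

lemma canonicalCycle_dotProduct_leeDifferential (y : Chain β) :
    canonicalCycle β ⬝ᵥ leeDifferential β y = 0 := by
  have hrow (g : Generator β) : leeCoeff g = ∑ ℓ, edgeCoeff ℓ g :=
    (Finset.sum_fn _ _).symm
  have h : canonicalCycle β ᵥ* Matrix.of (fun g' g => leeCoeff g g') = 0 := by
    funext g
    change canonicalCycle β ⬝ᵥ leeCoeff g = 0
    rw [hrow, dotProduct_sum]
    exact Finset.sum_eq_zero fun ℓ _ =>
      canonicalCycle_dotProduct_eq_zero ℓ fun g' => edgeCoeff_flipAt_right g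
  rw [leeDifferential, Matrix.mulVecLin_apply, Matrix.dotProduct_mulVec, h, zero_dotProduct]

lemma canonicalCycle_notMem_range :
    canonicalCycle β ∉ LinearMap.range (leeDifferential β) := by
  rintro ⟨y, hy⟩
  have h := canonicalCycle_dotProduct_leeDifferential y
  rw [hy] at h
  exact canonicalCycle_dotProduct_self_ne_zero h

lemma jtGrading_one_of_canonicalCycle_ne_zero {g : Generator β} (hg : canonicalCycle β g ≠ 0) :
    jtGrading 1 g = writhe β.toBraid := by
  simp [jtGrading_of_braidlike (canonicalCycle_apply_ne_zero_iff.1 hg)]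

lemma isGreatest_classGradings_canonicalCycle :
    IsGreatest (classGradings β 1 (canonicalCycle β)) (writhe β.toBraid : ℝ) := by
  have hub : (writhe β.toBraid : ℝ) ∈ upperBounds (classGradings β 1 (canonicalCycle β)) :=
    mem_upperBounds_classGradings canonicalCycle_dotProduct_leeDifferential
      (fun g hg => (jtGrading_one_of_canonicalCycle_ne_zero hg).le)
      canonicalCycle_dotProduct_self_ne_zero
  have hmem : chainGrading β 1 (canonicalCycle β) ∈ classGradings β 1 (canonicalCycle β) :=
    ⟨canonicalCycle β, leeDifferential_canonicalCycle, by simp, rfl⟩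
  have hle : (writhe β.toBraid : ℝ) ≤ chainGrading β 1 (canonicalCycle β) :=
    le_chainGrading canonicalCycle_ne_zero
      fun g hg => (jtGrading_one_of_canonicalCycle_ne_zero hg).ge
  exact ⟨le_antisymm hle (hub hmem) ▸ hmem, hub⟩

end AnnularLee

/-- For every braid `σ ∈ B_n` and every word `β` representing it, `d_1(σ̂, o_↑)` is the writhe of `σ`.
The first three conjuncts say that this value is meaningful: the canonical chain is a cycle, its
Lee homology class is nonzero, and the largest grading of a representative exists. -/
theorem theorem5p7 (n : ℕ) (σ : AnnularLee.BraidGroup n) (β : AnnularLee.BraidWord n)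
    (hβ : β.toBraid = σ) :
    AnnularLee.leeDifferential β (AnnularLee.canonicalCycle β) = 0 ∧
    AnnularLee.canonicalCycle β ∉ LinearMap.range (AnnularLee.leeDifferential β) ∧
    IsGreatest (AnnularLee.classGradings β 1 (AnnularLee.canonicalCycle β))
      (AnnularLee.annularRasmussen β 1) ∧
    AnnularLee.annularRasmussen β 1 = (AnnularLee.writhe σ : ℝ) := by
  subst hβ
  have hgreatest : IsGreatest (AnnularLee.classGradings β 1 (AnnularLee.canonicalCycle β))
      (AnnularLee.writhe β.toBraid : ℝ) :=
    AnnularLee.isGreatest_classGradings_canonicalCycle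
  have hd : AnnularLee.annularRasmussen β 1 = AnnularLee.writhe β.toBraid := hgreatest.csSup_eq
  exact ⟨AnnularLee.leeDifferential_canonicalCycle, AnnularLee.canonicalCycle_notMem_range,
    hd ▸ hgreatest, hd⟩
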